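/- Let $G=\prod_{j=0}^{\infty}\mathbb{Z}_2$ be the dyadic group with normalized Haar measure $\mu$ (the product of the uniform measures on $\mathbb{Z}_2$). For $n\in\mathbb{N}=\{0,1,2,\dots\}$ and $x\in G$ put $I_n(x)=\{y\in G: y_j=x_j \text{ for } j<n\}$ and let $\zeta_n$ be the $\sigma$-algebra generated by $\{I_n(x):x\in G\}$. For $n=\sum_{k} n_k2^k$ with $n_k\in\{0,1\}$ let $w_n(x)=\prod_{k}(-1)^{n_kx_k}$ be the $n$-th Walsh function. For a (real or complex) martingale $F=(F_n)_{n\in\mathbb{N}}$ with respect to $(\zeta_n)_{n\in\mathbb{N}}$ put $\widehat F(k)=\lim_{n\to\infty}\int_G F_nw_k\,d\mu$, $S_nF=\sum_{k=0}^{n-1}\widehat F(k)w_k$ and, for $n\ge 1$, $\sigma_nF=\frac1n\sum_{k=1}^nS_kF$. With $\|f\|_{1/2}=\left(\int_G|f|^{1/2}\,d\mu\right)^{2}$, let $H_{1/2}(G)$ consist of all such martingales with $\|F\|_{H_{1/2}}:=\left\|\sup_{n}|F_n|\right\|_{1/2}<\infty$. Then the restricted maximal operators $$\sup_{k\in\mathbb{N}}|\sigma_{2^k}F|,\qquad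 \sup_{k\in\mathbb{N}}|\sigma_{2^k+1}F|,\qquad \sup_{k\in\mathbb{N}}|\sigma_{2^k+2^{[k/2]}}F|,$$ where $[\cdot]$ denotes the integer part, are all bounded from $H_{1/2}(G)$ to $L_{1/2}(G)$: for each of them, denoted $T$, there is a finite constant $C$ such that $TF\in L_{1/2}(G)$ and $\|TF\|_{1/2}\le C\|F\|_{H_{1/2}}$ for every $F\in H_{1/2}(G)$. -/

import Mathlib

open MeasureTheory ProbabilityTheory Filter Topology
open scoped ENNReal NNReal

namespace WalshFejer

/-- The dyadic group: the complete direct product of countably many copies of `Z_2`. -/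
abbrev G : Type := ℕ → ZMod 2

/-- The uniform probability measure on `Z_2` (every singleton has measure `1/2`). -/
noncomputable def muZ2 : Measure (ZMod 2) := (2⁻¹ : ℝ≥0∞) • Measure.count

instance : IsProbabilityMeasure muZ2 := by
  constructor
  rw [muZ2, Measure.smul_apply, Measure.count_univ, ENat.card_eq_coe_fintype_card, ZMod.card]
  simp [ENNReal.inv_mul_cancel]

/-- The normalized Haar measure on `G`, i.e. the product of the uniform measures on `Z_2`. -/
noncomputable def mu : Measure G := Measure.infinitePi (fun _ : ℕ => muZ2)

instance : IsProbabilityMeasure mu := by unfold mu; infer_instance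

/-- The dyadic interval `I_n(x)`. -/
def dyadicInterval (n : ℕ) (x : G) : Set G := {y | ∀ j < n, y j = x j}

theorem measurableSet_dyadicInterval (n : ℕ) (x : G) : MeasurableSet (dyadicInterval n x) := by
  have h : dyadicInterval n x = ⋂ j ∈ Finset.range n, {y : G | y j = x j} := by
    ext y; simp [dyadicInterval]
  rw [h]
  exact Finset.measurableSet_biInter _ fun j _ =>
    measurableSet_eq_fun (measurable_pi_apply j) measurable_const

theorem dyadicInterval_eq_iUnion {m n : ℕ} (hmn : m ≤ n) (x : G) :
    dyadicInterval m x = ⋃ t : {t : Fin n → ZMod 2 // ∀ j : Fin n, j.1 < m → t j = x j},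
      dyadicInterval n (fun j => if h : j < n then t.1 ⟨j, h⟩ else 0) := by
  ext y
  simp only [dyadicInterval, Set.mem_ofPred_eq, Set.mem_iUnion]
  constructor
  · intro h
    refine ⟨⟨fun j => y j, fun j hj => h j hj⟩, fun j hj => by simp [hj]⟩
  · rintro ⟨⟨t, ht⟩, h⟩ j hj
    have hjn : j < n := lt_of_lt_of_le hj hmn
    have h1 := h j hjn
    simp only [hjn, dif_pos] at h1
    rw [h1]
    exact ht ⟨j, hjn⟩ hj

/-- The dyadic filtration: the `n`-th σ-algebra is generated by the intervals `I_n(x)`. -/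
def dyadicFiltration : Filtration ℕ (inferInstance : MeasurableSpace G) where
  seq n := MeasurableSpace.generateFrom {s | ∃ x : G, s = dyadicInterval n x}
  mono' := by
    intro m n hmn
    refine MeasurableSpace.generateFrom_le ?_
    rintro s ⟨x, rfl⟩
    rw [dyadicInterval_eq_iUnion hmn x]
    exact MeasurableSet.iUnion fun t => MeasurableSpace.measurableSet_generateFrom ⟨_, rfl⟩
  le' := by
    intro n
    refine MeasurableSpace.generateFrom_le ?_
    rintro s ⟨x, rfl⟩
    exact measurableSet_dyadicInterval n x

/-- The `k`-th Rademacher function `(-1)^{x_k}`. -/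
def rademacher (k : ℕ) (x : G) : ℝ := (-1) ^ (x k).val

/-- The `n`-th Walsh(–Paley) function `∏_k r_k^{n_k}`, where `n = ∑ n_k 2^k`. The binary digits
`n_k` with `k ≥ n.size` all vanish, so the product over `k < n.size` is the whole product. -/
def walsh (n : ℕ) (x : G) : ℝ :=
  ∏ k ∈ Finset.range n.size, rademacher k x ^ (n.testBit k).toNat

variable {𝕜 : Type*} [RCLike 𝕜]

/-- The maximal function `F^* = sup_n |F_n|`, with values in `[0, ∞]`. -/
noncomputable def maximalFunction (F : ℕ → G → 𝕜) (x : G) : ℝ≥0∞ := ⨆ n, ‖F n x‖ₑ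

/-- The Hardy (quasi-)norm `‖F‖_{H_p} = ‖F^*‖_p`, with values in `[0, ∞]`. -/
noncomputable def hardyNorm (p : ℝ≥0∞) (F : ℕ → G → 𝕜) : ℝ≥0∞ :=
  eLpNorm (maximalFunction F) p mu

/-- `F ∈ H_p(G)`: `F` is a dyadic martingale and `‖F‖_{H_p} < ∞`. -/
def MemHardy (p : ℝ≥0∞) (F : ℕ → G → 𝕜) : Prop :=
  Martingale F dyadicFiltration mu ∧ hardyNorm p F < ∞

/-- The `k`-th Walsh–Fourier coefficient `lim_n ∫ F_n w_k dμ` of a martingale `F`. The limit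
exists for every dyadic martingale, see `tendsto_walshFourierCoeff`. -/
noncomputable def walshFourierCoeff (F : ℕ → G → 𝕜) (k : ℕ) : 𝕜 :=
  limUnder atTop (fun n => ∫ x, walsh k x • F n x ∂mu)

/-- The partial sums `S_n F = ∑_{k < n} F̂(k) w_k`. -/
noncomputable def partialSum (n : ℕ) (F : ℕ → G → 𝕜) (x : G) : 𝕜 :=
  ∑ k ∈ Finset.range n, walsh k x • walshFourierCoeff F k

/-- The Fejér means `σ_n F = (1/n) ∑_{k=1}^n S_k F` (for `n ≥ 1`). -/
noncomputable def fejerMean (n : ℕ) (F : ℕ → G → 𝕜) (x : G) : 𝕜 :=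
  (n : 𝕜)⁻¹ * ∑ k ∈ Finset.Icc 1 n, partialSum k F x

/-- The restricted maximal operator `sup_k |σ_{n_k} F|`, with values in `[0, ∞]`. -/
noncomputable def restrictedMaximal (n : ℕ → ℕ) (F : ℕ → G → 𝕜) (x : G) : ℝ≥0∞ :=
  ⨆ k, ‖fejerMean (n k) F x‖ₑ

/-- The operator `T`, acting on martingales with scalars in `𝕜`, is bounded from `H_p(G)` to
`L_p(G)`: it maps `H_p(G)` to `L_p(G)` and `‖T F‖_p ≤ C ‖F‖_{H_p}` with one constant `C`. -/
def BoundedHardyLp (p : ℝ≥0∞) (T : (ℕ → G → 𝕜) → G → ℝ≥0∞) : Prop :=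
  ∃ C : ℝ≥0, ∀ F : ℕ → G → 𝕜, MemHardy p F →
    MemLp (T F) p mu ∧ eLpNorm (T F) p mu ≤ C * hardyNorm p F

theorem stronglyMeasurable_walsh (k : ℕ) :
    StronglyMeasurable[dyadicFiltration k.size] (walsh k) := by
  let _ : MeasurableSpace G := dyadicFiltration k.size
  have hm : Measurable (walsh k) := by
    intro s _
    have : walsh k ⁻¹' s = ⋃ t : {t : Fin k.size → ZMod 2 //
        walsh k (fun j => if h : j < k.size then t ⟨j, h⟩ else 0) ∈ s},
        dyadicInterval k.size (fun j => if h : j < k.size then t.1 ⟨j, h⟩ else 0) := by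
      have key : ∀ x y : G, x ∈ dyadicInterval k.size y → walsh k x = walsh k y := by
        intro x y h
        refine Finset.prod_congr rfl fun j hj => ?_
        rw [rademacher, rademacher, h j (Finset.mem_range.1 hj)]
      ext y
      simp only [Set.mem_preimage, Set.mem_iUnion]
      constructor
      · intro h
        have hy : y ∈ dyadicInterval k.size
            (fun j => if h : j < k.size then y j else 0) := fun j hj => by simp [hj]
        exact ⟨⟨fun j => y j, (key _ _ hy) ▸ h⟩, hy⟩
      · rintro ⟨⟨t, ht⟩, h⟩
        rw [key _ _ h]
        exact ht
    rw [this]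
    exact MeasurableSet.iUnion fun t => MeasurableSpace.measurableSet_generateFrom ⟨_, rfl⟩
  exact hm.stronglyMeasurable

theorem abs_walsh_le (k : ℕ) (x : G) : ‖walsh k x‖ ≤ 1 := by
  rw [walsh, norm_prod]
  refine Finset.prod_le_one (fun _ _ => norm_nonneg _) fun j _ => ?_
  simp [rademacher]

/-- For a dyadic martingale the integrals `∫ F_n w_k dμ` are eventually constant in `n`, so the
limit defining the Walsh–Fourier coefficients exists. -/
theorem tendsto_walshFourierCoeff {F : ℕ → G → 𝕜} (hF : Martingale F dyadicFiltration mu) (k : ℕ) :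
    Tendsto (fun n => ∫ x, walsh k x • F n x ∂mu) atTop (𝓝 (walshFourierCoeff F k)) := by
  have hconst : ∀ n, k.size ≤ n →
      ∫ x, walsh k x • F n x ∂mu = ∫ x, walsh k x • F k.size x ∂mu := by
    intro n hn
    have hsm := stronglyMeasurable_walsh k
    have hle := dyadicFiltration.le k.size
    have hint : Integrable (walsh k • F n) mu :=
      (hF.integrable n).bdd_smul 1 (hsm.mono hle).aestronglyMeasurable
        (ae_of_all _ (abs_walsh_le k))
    have h1 := condExp_smul_of_aestronglyMeasurable_left (μ := mu)
      hsm.aestronglyMeasurable hint (hF.integrable n)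
    have h2 := hF.2 _ _ hn
    change ∫ x, (walsh k • F n) x ∂mu = _
    rw [← integral_condExp hle]
    refine integral_congr_ae ?_
    filter_upwards [h1, h2] with x hx1 hx2
    rw [hx1, Pi.smul_apply', hx2]
  refine tendsto_nhds_limUnder ⟨∫ x, walsh k x • F k.size x ∂mu, ?_⟩
  exact tendsto_const_nhds.congr' (by
    filter_upwards [eventually_ge_atTop k.size] with n hn
    exact (hconst n hn).symm)

end WalshFejer

/-! Write `B` for the square root of the maximal function of `F`. Since the quasinorm in L_{1/2} is
the square of the integral of the square root, it suffices to find `Z` with |σ_{n_k} F| ≤ Z² for all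
k and ∫ Z ≤ C ∫ B (`boundedHardyLp_of_le_sq`). No atomic decomposition is used.

For n = 2^k, twice the Fejér sum is an explicit combination of the translates S_{2^k}F(x + e_t), t <
k, with weights 2^t, and of S_{2^k}F(x) (`two_mul_fejerSum_two_pow`); moreover S_{2^k}F = F_k.
Taking square roots leaves translates of b_k = max_{i ≤ k} |F_i|^{1/2} with geometric weights
2^{(t-k)/2}. Because b_t(x + e_t) = b_t(x) ≤ B(x), only the increments of b after level t see the
translation. Their weighted translates, summed over all levels, do not depend on k, and their
integral is at most 3 ∫ B, because translations preserve the measure and the increments telescope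
(`IsEnvelope.flipSum_le`, `IsEnvelope.lintegral_incrementFlipSum_le`).

For n = 2^k + 2^s with s ≤ k there is one new term, the Fejér sum of order 2^s of the coefficients
shifted by 2^k. Its dyadic partial sums come from averaging the block of frequencies [2^k, 2^{k+1})
down to level s. Each averaging step leaves b with coefficient 1 and multiplies the integral of the
error by 2^{1/2} (`IsEnvelope.le_sq_add_remainder`). The factor (2^s/2^k)^{1/2} from the
normalization compensates this growth, so the errors are summable even over all k. -/

namespace WalshFejer

/-! ### Coordinate flips and Walsh functions -/

/-- The translation of `G` by the `t`-th unit vector. -/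
def flip (t : ℕ) (x : G) : G := fun j => x j + if j = t then 1 else 0

theorem flip_apply_of_ne {t j : ℕ} (h : j ≠ t) (x : G) : flip t x j = x j := by
  simp [flip, h]

theorem rademacher_flip_of_ne {t j : ℕ} (h : j ≠ t) (x : G) :
    rademacher j (flip t x) = rademacher j x := by
  rw [rademacher, rademacher, flip_apply_of_ne h]

theorem neg_one_pow_val_add_one (a : ZMod 2) : (-1 : ℝ) ^ (a + 1).val = -(-1) ^ a.val := by
  fin_cases a
  · change (-1 : ℝ) ^ 1 = -(-1) ^ 0
    norm_num
  · change (-1 : ℝ) ^ 0 = -(-1) ^ 1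
    norm_num

theorem rademacher_flip_self (t : ℕ) (x : G) :
    rademacher t (flip t x) = -rademacher t x := by
  simp [rademacher, flip, neg_one_pow_val_add_one]

theorem rademacher_mul_self (t : ℕ) (x : G) : rademacher t x * rademacher t x = 1 := by
  rw [rademacher, ← mul_pow]
  simp

theorem walsh_eq_prod {n m : ℕ} (h : n < 2 ^ m) (x : G) :
    walsh n x = ∏ k ∈ Finset.range m, rademacher k x ^ (n.testBit k).toNat := by
  rw [walsh]
  refine Finset.prod_subset (Finset.range_mono (Nat.size_le.2 h)) fun k _ hk => ?_
  rw [Finset.mem_range, not_lt] at hk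
  rw [Nat.testBit_lt_two_pow (Nat.size_le.1 hk)]
  simp

theorem walsh_two_pow_add {s l : ℕ} (h : l < 2 ^ s) (x : G) :
    walsh (2 ^ s + l) x = rademacher s x * walsh l x := by
  rw [walsh_eq_prod (m := s + 1) (by rw [pow_succ]; omega), walsh_eq_prod h,
    Finset.prod_range_succ, mul_comm, Nat.testBit_two_pow_add_eq, Nat.testBit_lt_two_pow h]
  congr 1
  · simp
  · refine Finset.prod_congr rfl fun j hj => ?_
    rw [Nat.testBit_two_pow_add_gt (Finset.mem_range.1 hj)]

theorem walsh_flip {l t : ℕ} (h : l < 2 ^ t) (x : G) : walsh l (flip t x) = walsh l x := by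
  rw [walsh_eq_prod h, walsh_eq_prod h]
  refine Finset.prod_congr rfl fun j hj => ?_
  rw [rademacher_flip_of_ne (Finset.mem_range.1 hj).ne]

theorem measurable_walsh (k : ℕ) : Measurable (walsh k) :=
  ((stronglyMeasurable_walsh k).mono (dyadicFiltration.le _)).measurable

/-! ### Partial sums and Fejér sums of Walsh series -/

variable {𝕜 : Type*} [RCLike 𝕜]

/-- The partial sum of the first `n` terms of the Walsh series with coefficients `c`. -/
noncomputable def walshSum (c : ℕ → 𝕜) (n : ℕ) (x : G) : 𝕜 :=
  ∑ k ∈ Finset.range n, walsh k x • c k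

/-- The sum of the first `n` partial sums of the Walsh series with coefficients `c`. -/
noncomputable def fejerSum (c : ℕ → 𝕜) (n : ℕ) (x : G) : 𝕜 :=
  ∑ j ∈ Finset.range n, walshSum c (j + 1) x

theorem measurable_walshSum (c : ℕ → 𝕜) (n : ℕ) : Measurable (walshSum c n) :=
  Finset.measurable_fun_sum _ fun k _ => (measurable_walsh k).smul_const (c k)

theorem measurable_fejerSum (c : ℕ → 𝕜) (n : ℕ) : Measurable (fejerSum c n) :=
  Finset.measurable_fun_sum _ fun j _ => measurable_walshSum c (j + 1)

theorem fejerMean_eq (n : ℕ) (F : ℕ → G → 𝕜) (x : G) :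
    fejerMean n F x = (n : 𝕜)⁻¹ * fejerSum (walshFourierCoeff F) n x := by
  rw [fejerMean, fejerSum, Finset.range_eq_Ico,
    Finset.sum_Ico_add' (fun j => walshSum (walshFourierCoeff F) j x) 0 n 1]
  rfl

theorem walshSum_flip (c : ℕ → 𝕜) {n t : ℕ} (h : n ≤ 2 ^ t) (x : G) :
    walshSum c n (flip t x) = walshSum c n x :=
  Finset.sum_congr rfl fun k hk => by rw [walsh_flip ((Finset.mem_range.1 hk).trans_le h)]

theorem walshSum_two_pow_add (c : ℕ → 𝕜) {s i : ℕ} (h : i ≤ 2 ^ s) (x : G) :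
    walshSum c (2 ^ s + i) x =
      walshSum c (2 ^ s) x + rademacher s x • walshSum (fun l => c (2 ^ s + l)) i x := by
  rw [walshSum, Finset.sum_range_add, walshSum, walshSum, Finset.smul_sum]
  congr 1
  refine Finset.sum_congr rfl fun l hl => ?_
  rw [walsh_two_pow_add ((Finset.mem_range.1 hl).trans_le h), mul_smul]

theorem fejerSum_two_pow_add (c : ℕ → 𝕜) {s i : ℕ} (h : i ≤ 2 ^ s) (x : G) :
    fejerSum c (2 ^ s + i) x = fejerSum c (2 ^ s) x + i * walshSum c (2 ^ s) x +
      rademacher s x • fejerSum (fun l => c (2 ^ s + l)) i x := by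
  rw [fejerSum, Finset.sum_range_add, add_assoc]
  congr 1
  rw [fejerSum, Finset.smul_sum, ← nsmul_eq_mul, ← Finset.card_range i, ← Finset.sum_const,
    Finset.card_range, ← Finset.sum_add_distrib]
  refine Finset.sum_congr rfl fun l hl => ?_
  rw [add_assoc, walshSum_two_pow_add c (by have := Finset.mem_range.1 hl; omega)]

theorem walshSum_two_pow_succ (c : ℕ → 𝕜) (s : ℕ) (x : G) :
    walshSum c (2 ^ (s + 1)) x =
      walshSum c (2 ^ s) x + rademacher s x • walshSum (fun l => c (2 ^ s + l)) (2 ^ s) x := by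
  rw [pow_succ, mul_two, walshSum_two_pow_add c le_rfl]

/-- Averaging over the flip of coordinate s cancels the frequencies in [2^s, 2^{s+1}): this is the
conditional expectation from level s + 1 to level s. -/
theorem two_mul_walshSum_two_pow (c : ℕ → 𝕜) (s : ℕ) (x : G) :
    2 * walshSum c (2 ^ s) x =
      walshSum c (2 ^ (s + 1)) x + walshSum c (2 ^ (s + 1)) (flip s x) := by
  rw [walshSum_two_pow_succ, walshSum_two_pow_succ, walshSum_flip _ le_rfl,
    walshSum_flip _ le_rfl, rademacher_flip_self, neg_smul]
  ring

/-- The part of the Walsh series with frequencies in `[2 ^ s, 2 ^ (s + 1))`. -/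
theorem two_mul_walshSum_shift (c : ℕ → 𝕜) (s : ℕ) (x : G) :
    2 * walshSum (fun l => c (2 ^ s + l)) (2 ^ s) x = rademacher s x •
      (walshSum c (2 ^ (s + 1)) x - walshSum c (2 ^ (s + 1)) (flip s x)) := by
  rw [walshSum_two_pow_succ, walshSum_two_pow_succ, walshSum_flip _ le_rfl,
    walshSum_flip _ le_rfl, rademacher_flip_self]
  have h : (rademacher s x : 𝕜) * rademacher s x = 1 := by
    rw [← RCLike.ofReal_mul, rademacher_mul_self, RCLike.ofReal_one]
  simp only [RCLike.real_smul_eq_coe_mul, RCLike.ofReal_neg]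
  linear_combination (-2 * walshSum (fun l => c (2 ^ s + l)) (2 ^ s) x) * h

/-- The Fejér kernel of order `2 ^ s` as a combination of dyadic averages. -/
theorem two_mul_fejerSum_two_pow (c : ℕ → 𝕜) (s : ℕ) (x : G) :
    2 * fejerSum c (2 ^ s) x =
      ∑ t ∈ Finset.range s, 2 ^ t * walshSum c (2 ^ s) (flip t x) +
        (2 ^ s + 1) * walshSum c (2 ^ s) x := by
  induction s generalizing c with
  | zero => simp [fejerSum, one_add_one_eq_two]
  | succ s ih =>
    have h1 := ih c
    -- The upper half of the series is again a Walsh series, with shifted coefficients; hence the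
    -- induction over all `c`.
    have h2 := ih fun l => c (2 ^ s + l)
    have h3 : ∀ y, walshSum c (2 ^ (s + 1)) y = walshSum c (2 ^ s) y +
      (rademacher s y : 𝕜) * walshSum (fun l => c (2 ^ s + l)) (2 ^ s) y := by
      intro y
      rw [walshSum_two_pow_succ, RCLike.real_smul_eq_coe_mul]
    have h4 : fejerSum c (2 ^ (s + 1)) x = fejerSum c (2 ^ s) x + 2 ^ s * walshSum c (2 ^ s) x +
        (rademacher s x : 𝕜) * fejerSum (fun l => c (2 ^ s + l)) (2 ^ s) x := by
      rw [pow_succ, mul_two, fejerSum_two_pow_add c le_rfl, RCLike.real_smul_eq_coe_mul]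
      push_cast
      ring
    have h5 : ∑ t ∈ Finset.range s, 2 ^ t * walshSum c (2 ^ (s + 1)) (flip t x) =
        ∑ t ∈ Finset.range s, 2 ^ t * walshSum c (2 ^ s) (flip t x) +
          (rademacher s x : 𝕜) * ∑ t ∈ Finset.range s,
            2 ^ t * walshSum (fun l => c (2 ^ s + l)) (2 ^ s) (flip t x) := by
      rw [Finset.mul_sum, ← Finset.sum_add_distrib]
      refine Finset.sum_congr rfl fun t ht => ?_
      rw [h3, rademacher_flip_of_ne (Finset.mem_range.1 ht).ne']
      ring
    have h6 : walshSum c (2 ^ (s + 1)) (flip s x) = walshSum c (2 ^ s) x -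
        (rademacher s x : 𝕜) * walshSum (fun l => c (2 ^ s + l)) (2 ^ s) x := by
      rw [h3, walshSum_flip _ le_rfl, walshSum_flip _ le_rfl, rademacher_flip_self]
      push_cast
      ring
    rw [h4, Finset.sum_range_succ, h5, h6, h3]
    linear_combination h1 + (rademacher s x : 𝕜) * h2

/-! ### Translation invariance and measure of dyadic intervals -/

theorem measurePreserving_flip (t : ℕ) : MeasurePreserving (flip t) mu mu := by
  have hinv : ∀ a : ZMod 2, muZ2.map (fun z => z + a) = muZ2 := by
    intro a
    ext s hs
    have hm : Measurable fun z : ZMod 2 => z + a := measurable_of_finite _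
    rw [Measure.map_apply hm hs]
    simp only [muZ2, Measure.smul_apply]
    congr 1
    rw [Measure.count_apply (hm hs), Measure.count_apply hs]
    congr 1
    exact Set.encard_preimage_of_bijective (Equiv.addRight a).bijective s
  have hm : ∀ j, Measurable fun z : ZMod 2 => z + if j = t then 1 else 0 :=
    fun j => measurable_of_finite _
  refine ⟨measurable_pi_lambda _ fun j => (hm j).comp (measurable_pi_apply j), ?_⟩
  have := Measure.infinitePi_map_pi (μ := fun _ : ℕ => muZ2)
    (f := fun j z => z + if j = t then 1 else 0) hm
  simp only [hinv] at this
  exact this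

theorem lintegral_flip (t : ℕ) {h : G → ℝ≥0∞} (hh : Measurable h) :
    ∫⁻ x, h (flip t x) ∂mu = ∫⁻ x, h x ∂mu :=
  (measurePreserving_flip t).lintegral_comp hh

theorem mu_dyadicInterval (n : ℕ) (x : G) : mu (dyadicInterval n x) = 2⁻¹ ^ n := by
  have h : dyadicInterval n x = Set.pi (Finset.range n : Set ℕ) fun j => {x j} := by
    ext y; simp [dyadicInterval]
  rw [h, mu, Measure.infinitePi_pi _ fun j _ => measurableSet_singleton _]
  simp [muZ2]

/-! ### The dyadic partial sums of a martingale -/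

/-- No set of the n-th σ-algebra separates two points of the same interval. This makes the later
identity S_{2^n}F = F_n hold at every point, not only almost everywhere. -/
theorem eq_of_mem_dyadicInterval {n : ℕ} {f : G → 𝕜}
    (hf : StronglyMeasurable[dyadicFiltration n] f) {x y : G} (hy : y ∈ dyadicInterval n x) :
    f y = f x := by
  have key : ∀ s : Set G, MeasurableSet[dyadicFiltration n] s → (x ∈ s ↔ y ∈ s) := by
    refine MeasurableSpace.generateFrom_induction _ _ ?_ ?_ ?_ ?_
    · rintro _ ⟨z, rfl⟩ -
      refine forall₂_congr fun j hj => ?_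
      rw [hy j hj]
    · simp
    · intro s _ hs
      simp [hs]
    · intro s _ hs
      simp [hs]
  exact (key _ (hf.measurable (measurableSet_singleton (f x)))).1 rfl

open Classical in
-- The Dirichlet kernel of order 2^n factors as the product over j < n of 1 + r_j(x) r_j(y), and
-- each factor is 2 or 0.
theorem sum_walsh_mul_walsh (n : ℕ) (x y : G) :
    ∑ k ∈ Finset.range (2 ^ n), walsh k x * walsh k y =
      if y ∈ dyadicInterval n x then 2 ^ n else 0 := by
  induction n with
  | zero => simp [dyadicInterval, walsh]
  | succ n ih =>
    have h1 : ∑ k ∈ Finset.range (2 ^ (n + 1)), walsh k x * walsh k y =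
        (1 + rademacher n x * rademacher n y) *
          ∑ k ∈ Finset.range (2 ^ n), walsh k x * walsh k y := by
      rw [pow_succ, mul_two, Finset.sum_range_add, add_mul, one_mul, Finset.mul_sum]
      congr 1
      refine Finset.sum_congr rfl fun l hl => ?_
      rw [walsh_two_pow_add (Finset.mem_range.1 hl), walsh_two_pow_add (Finset.mem_range.1 hl)]
      ring
    have h2 : y ∈ dyadicInterval (n + 1) x ↔ y ∈ dyadicInterval n x ∧ y n = x n := by
      simp only [dyadicInterval, Set.mem_ofPred_eq, Nat.lt_succ_iff_lt_or_eq, or_imp,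
        forall_and, forall_eq]
    have h3 : rademacher n x * rademacher n y = if y n = x n then 1 else -1 := by
      split_ifs with h
      · rw [rademacher, rademacher, h, ← mul_pow]
        simp
      · have hne : ∀ a b : ZMod 2, b ≠ a → b = a + 1 := by decide
        rw [rademacher, rademacher, hne _ _ h, neg_one_pow_val_add_one, mul_neg, ← mul_pow]
        simp
    rw [h1, ih, h3]
    by_cases ha : y ∈ dyadicInterval n x <;> by_cases hb : y n = x n <;> simp [h2, ha, hb]
    ring

theorem integrable_walsh_smul (k : ℕ) {f : G → 𝕜} (hf : Integrable f mu) :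
    Integrable (fun x => walsh k x • f x) mu :=
  hf.bdd_smul 1 (measurable_walsh k).aestronglyMeasurable (ae_of_all _ (abs_walsh_le k))

theorem sum_walsh_smul_integral {n : ℕ} {f : G → 𝕜}
    (hf : StronglyMeasurable[dyadicFiltration n] f) (hi : Integrable f mu) (x : G) :
    ∑ k ∈ Finset.range (2 ^ n), walsh k x • ∫ y, walsh k y • f y ∂mu = f x := by
  classical
  have h1 : ∀ y, ∑ k ∈ Finset.range (2 ^ n), walsh k x • walsh k y • f y =
      (dyadicInterval n x).indicator (fun _ => (2 ^ n : ℝ) • f x) y := by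
    intro y
    simp only [smul_smul, ← Finset.sum_smul, sum_walsh_mul_walsh, Set.indicator]
    split_ifs with h
    · rw [eq_of_mem_dyadicInterval hf h]
    · simp
  simp only [← integral_smul]
  rw [← integral_finsetSum (f := fun k y => walsh k x • walsh k y • f y) _ fun k _ => by
    exact (integrable_walsh_smul k hi).smul (walsh k x)]
  simp only [h1]
  rw [integral_indicator_const _ (measurableSet_dyadicInterval n x), Measure.real,
    mu_dyadicInterval, smul_smul, ENNReal.toReal_pow, ENNReal.toReal_inv, ← mul_pow]
  simp

theorem walshFourierCoeff_eq {F : ℕ → G → 𝕜} (hF : Martingale F dyadicFiltration mu) {k n : ℕ}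
    (h : k < 2 ^ n) : walshFourierCoeff F k = ∫ x, walsh k x • F n x ∂mu := by
  refine tendsto_nhds_unique (tendsto_walshFourierCoeff hF k) (tendsto_const_nhds.congr' ?_)
  filter_upwards [eventually_ge_atTop n] with m hm
  have hsm : StronglyMeasurable[dyadicFiltration n] (walsh k) :=
    (stronglyMeasurable_walsh k).mono (dyadicFiltration.mono (Nat.size_le.2 h))
  have h1 := condExp_smul_of_aestronglyMeasurable_left (μ := mu)
    hsm.aestronglyMeasurable (integrable_walsh_smul k (hF.integrable m)) (hF.integrable m)
  change _ = ∫ x, (walsh k • F m) x ∂mu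
  rw [← integral_condExp (f := walsh k • F m) (dyadicFiltration.le n)]
  refine integral_congr_ae ?_
  filter_upwards [h1, hF.2 _ _ hm] with x hx1 hx2
  rw [hx1, Pi.smul_apply', hx2]

theorem walshSum_walshFourierCoeff_two_pow {F : ℕ → G → 𝕜}
    (hF : Martingale F dyadicFiltration mu) (n : ℕ) (x : G) :
    walshSum (walshFourierCoeff F) (2 ^ n) x = F n x := by
  rw [← sum_walsh_smul_integral (hF.1 n) (hF.integrable n) x, walshSum]
  exact Finset.sum_congr rfl fun k hk => by
    rw [walshFourierCoeff_eq hF (Finset.mem_range.1 hk)]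

/-! ### The constant `2 ^ (-1/2)` and weighted sums of translates -/

/-- The number `2 ^ (-1/2)` as an extended nonnegative real. -/
noncomputable def theta : ℝ≥0∞ := (NNReal.sqrt 2⁻¹ : ℝ≥0)

theorem two_mul_theta_sq : 2 * theta ^ 2 = 1 := by
  rw [theta, ← ENNReal.coe_pow, NNReal.sq_sqrt]
  norm_cast
  exact mul_inv_cancel₀ two_ne_zero

theorem one_le_two_mul_theta : 1 ≤ 2 * theta := by
  have h : (2⁻¹ : ℝ≥0) ≤ NNReal.sqrt 2⁻¹ := by
    rw [NNReal.le_sqrt_iff_sq_le]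
    norm_num [sq, ← NNReal.coe_le_coe]
  calc (1 : ℝ≥0∞) = ((2 * 2⁻¹ : ℝ≥0) : ℝ≥0∞) := by norm_num
    _ ≤ 2 * theta := by
      rw [theta]
      exact_mod_cast mul_le_mul_right h 2

/-- In the form θ(3 + 1) ≤ 3 this closes every induction below that bounds a geometric sum of ratio
θ. -/
theorem four_mul_theta_le : 4 * theta ≤ 3 := by
  have h : NNReal.sqrt 2⁻¹ ≤ 3 / 4 := by
    rw [NNReal.sqrt_le_iff_le_sq]
    norm_num [← NNReal.coe_le_coe]
  rw [theta]
  have h2 : (4 : ℝ≥0) * NNReal.sqrt 2⁻¹ ≤ 3 := by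
    calc (4 : ℝ≥0) * NNReal.sqrt 2⁻¹ ≤ 4 * (3 / 4) := mul_le_mul_right h 4
      _ = 3 := by norm_num [← NNReal.coe_inj]
  exact_mod_cast h2

theorem theta_le_one : theta ≤ 1 := by
  by_contra! h
  have h1 : (4 : ℝ≥0∞) * 1 ≤ 3 := (mul_le_mul_right h.le 4).trans four_mul_theta_le
  norm_num at h1

theorem two_pow_mul_theta_pow {t k : ℕ} (h : t ≤ k) :
    2 ^ t * theta ^ (2 * k) = (theta ^ (k - t)) ^ 2 := by
  obtain ⟨j, rfl⟩ := Nat.exists_eq_add_of_le h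
  rw [Nat.add_sub_cancel_left, ← pow_mul, mul_add, pow_add, ← mul_assoc, pow_mul theta 2 t,
    ← mul_pow, two_mul_theta_sq, one_pow, one_mul, mul_comm]

/-- The weighted sum of translates `h(x) + ∑_{t < k} 2^{(t-k)/2} h(x + e_t)`. -/
noncomputable def flipSum (k : ℕ) (h : G → ℝ≥0∞) (x : G) : ℝ≥0∞ :=
  h x + ∑ t ∈ Finset.range k, theta ^ (k - t) * h (flip t x)

theorem measurable_flip (t : ℕ) : Measurable (flip t) := (measurePreserving_flip t).measurable

theorem measurable_sum_flip (k : ℕ) {h : G → ℝ≥0∞} (hh : Measurable h) :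
    Measurable fun x => ∑ t ∈ Finset.range k, theta ^ (k - t) * h (flip t x) :=
  Finset.measurable_fun_sum _ fun t _ => (hh.comp (measurable_flip t)).const_mul _

theorem measurable_flipSum (k : ℕ) {h : G → ℝ≥0∞} (hh : Measurable h) :
    Measurable (flipSum k h) :=
  hh.add (measurable_sum_flip k hh)

theorem le_flipSum (k : ℕ) (h : G → ℝ≥0∞) (x : G) : h x ≤ flipSum k h x := le_self_add

theorem flipSum_add (k : ℕ) (g h : G → ℝ≥0∞) (x : G) :
    flipSum k (fun y => g y + h y) x = flipSum k g x + flipSum k h x := by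
  simp only [flipSum, mul_add, Finset.sum_add_distrib]
  ring

theorem sum_theta_pow_le (k : ℕ) : ∑ t ∈ Finset.range k, theta ^ (k - t) ≤ 3 := by
  induction k with
  | zero => simp
  | succ k ih =>
    have h : ∑ t ∈ Finset.range (k + 1), theta ^ (k + 1 - t) =
        theta * (∑ t ∈ Finset.range k, theta ^ (k - t) + 1) := by
      rw [Finset.sum_range_succ, mul_add, Finset.mul_sum]
      congr 1
      · refine Finset.sum_congr rfl fun t ht => ?_
        rw [Nat.succ_sub (Finset.mem_range.1 ht).le, pow_succ']
      · simp
    calc _ = theta * (∑ t ∈ Finset.range k, theta ^ (k - t) + 1) := h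
      _ ≤ theta * (3 + 1) := by gcongr
      _ = 4 * theta := by ring
      _ ≤ 3 := four_mul_theta_le

theorem lintegral_sum_flip_le (k : ℕ) {h : G → ℝ≥0∞} (hh : Measurable h) :
    ∫⁻ x, ∑ t ∈ Finset.range k, theta ^ (k - t) * h (flip t x) ∂mu ≤ 3 * ∫⁻ x, h x ∂mu := by
  have hm : ∀ t, Measurable fun x => h (flip t x) := fun t => hh.comp (measurable_flip t)
  rw [lintegral_finsetSum _ fun t _ => (hm t).const_mul _]
  calc ∑ t ∈ Finset.range k, ∫⁻ x, theta ^ (k - t) * h (flip t x) ∂mu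
      = (∑ t ∈ Finset.range k, theta ^ (k - t)) * ∫⁻ x, h x ∂mu := by
        rw [Finset.sum_mul]
        refine Finset.sum_congr rfl fun t _ => ?_
        rw [lintegral_const_mul _ (hm t), lintegral_flip t hh]
    _ ≤ 3 * ∫⁻ x, h x ∂mu := by
        gcongr
        exact sum_theta_pow_le k

theorem lintegral_flipSum_le (k : ℕ) {h : G → ℝ≥0∞} (hh : Measurable h) :
    ∫⁻ x, flipSum k h x ∂mu ≤ 4 * ∫⁻ x, h x ∂mu := by
  calc ∫⁻ x, flipSum k h x ∂mu = ∫⁻ x, h x ∂mu +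
        ∫⁻ x, ∑ t ∈ Finset.range k, theta ^ (k - t) * h (flip t x) ∂mu := lintegral_add_left hh _
    _ ≤ ∫⁻ x, h x ∂mu + 3 * ∫⁻ x, h x ∂mu := by
        gcongr
        exact lintegral_sum_flip_le k hh
    _ = 4 * ∫⁻ x, h x ∂mu := by ring

theorem sum_sq_le_sq_sum {ι : Type*} (s : Finset ι) (f : ι → ℝ≥0∞) :
    ∑ i ∈ s, f i ^ 2 ≤ (∑ i ∈ s, f i) ^ 2 := by
  rw [sq, Finset.sum_mul]
  refine Finset.sum_le_sum fun i hi => ?_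
  rw [sq]
  gcongr
  exact Finset.single_le_sum (fun _ _ => zero_le) hi

theorem sq_add_sq_le (a b : ℝ≥0∞) : a ^ 2 + b ^ 2 ≤ (a + b) ^ 2 := by
  calc a ^ 2 + b ^ 2 ≤ a ^ 2 + b ^ 2 + 2 * a * b := le_self_add
    _ = (a + b) ^ 2 := by ring

theorem enorm_two : ‖(2 : 𝕜)‖ₑ = 2 := by
  rw [← ofReal_norm, RCLike.norm_ofNat]
  simp

theorem enorm_rademacher_smul (s : ℕ) (x : G) (z : 𝕜) : ‖rademacher s x • z‖ₑ = ‖z‖ₑ := by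
  rw [← ofReal_norm, ← ofReal_norm, norm_smul]
  simp [rademacher]

theorem enorm_fejerSum_two_pow_le (c : ℕ → 𝕜) (k : ℕ) (x : G) :
    ‖fejerSum c (2 ^ k) x‖ₑ ≤
      ∑ t ∈ Finset.range k, 2 ^ t * ‖walshSum c (2 ^ k) (flip t x)‖ₑ +
        2 ^ k * ‖walshSum c (2 ^ k) x‖ₑ := by
  have h : 2 * ‖fejerSum c (2 ^ k) x‖ₑ ≤ 2 * (∑ t ∈ Finset.range k,
      2 ^ t * ‖walshSum c (2 ^ k) (flip t x)‖ₑ + 2 ^ k * ‖walshSum c (2 ^ k) x‖ₑ) := by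
    calc 2 * ‖fejerSum c (2 ^ k) x‖ₑ = ‖2 * fejerSum c (2 ^ k) x‖ₑ := by
          rw [enorm_mul, enorm_two]
      _ ≤ ∑ t ∈ Finset.range k, 2 ^ t * ‖walshSum c (2 ^ k) (flip t x)‖ₑ +
          (2 ^ k + 1) * ‖walshSum c (2 ^ k) x‖ₑ := by
          rw [two_mul_fejerSum_two_pow]
          refine (enorm_add_le _ _).trans (add_le_add ((enorm_sum_le _ _).trans_eq ?_) ?_)
          · simp only [enorm_mul, enorm_pow, enorm_two]
          · rw [enorm_mul]
            gcongr
            refine (enorm_add_le _ _).trans_eq ?_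
            rw [enorm_pow, enorm_two, enorm_one]
      _ ≤ 2 * ∑ t ∈ Finset.range k, 2 ^ t * ‖walshSum c (2 ^ k) (flip t x)‖ₑ +
          (2 * 2 ^ k) * ‖walshSum c (2 ^ k) x‖ₑ := by
          gcongr
          · exact le_mul_of_one_le_left zero_le one_le_two
          · rw [two_mul]
            gcongr
            exact one_le_pow₀ one_le_two
      _ = _ := by ring
  exact (ENNReal.mul_le_mul_iff_right two_ne_zero ENNReal.ofNat_ne_top).1 h

/-- Here `theta ^ (2 * k)` is 2^{-k}. Subadditivity of the square root, as Σ a² ≤ (Σ a)², turns the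
weights 2^{t-k} into θ^{k-t}. -/
theorem theta_pow_mul_enorm_fejerSum_le {c : ℕ → 𝕜} {k : ℕ} {u : G → ℝ≥0∞}
    (h : ∀ y, ‖walshSum c (2 ^ k) y‖ₑ ≤ u y ^ 2) (x : G) :
    theta ^ (2 * k) * ‖fejerSum c (2 ^ k) x‖ₑ ≤ flipSum k u x ^ 2 := by
  calc theta ^ (2 * k) * ‖fejerSum c (2 ^ k) x‖ₑ
      ≤ theta ^ (2 * k) * (∑ t ∈ Finset.range k, 2 ^ t * u (flip t x) ^ 2 +
          2 ^ k * u x ^ 2) := by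
        gcongr
        refine (enorm_fejerSum_two_pow_le c k x).trans ?_
        gcongr <;> exact h _
    _ = u x ^ 2 + ∑ t ∈ Finset.range k, (theta ^ (k - t) * u (flip t x)) ^ 2 := by
        rw [mul_add, add_comm, Finset.mul_sum]
        congr 1
        · rw [← mul_assoc, mul_comm (theta ^ _), two_pow_mul_theta_pow le_rfl]
          simp
        · refine Finset.sum_congr rfl fun t ht => ?_
          rw [mul_pow, ← two_pow_mul_theta_pow (Finset.mem_range.1 ht).le]
          ring
    _ ≤ u x ^ 2 + (∑ t ∈ Finset.range k, theta ^ (k - t) * u (flip t x)) ^ 2 := by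
        gcongr
        exact sum_sq_le_sq_sum _ _
    _ ≤ flipSum k u x ^ 2 := sq_add_sq_le _ _

/-! ### Increasing envelopes -/

/-- The increments of a sequence of functions. -/
noncomputable def increment (b : ℕ → G → ℝ≥0∞) (n : ℕ) (x : G) : ℝ≥0∞ := b (n + 1) x - b n x

/-- An increasing sequence of measurable functions, the `n`-th of which is invariant under
flipping the coordinates with index at least `n`. -/
structure IsEnvelope (b : ℕ → G → ℝ≥0∞) : Prop where
  measurable : ∀ n, Measurable (b n)
  le_succ : ∀ n x, b n x ≤ b (n + 1) x
  flip_self : ∀ n x, b n (flip n x) = b n x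

/-- The sum of the weighted translates of all increments of `b`. -/
noncomputable def incrementFlipSum (b : ℕ → G → ℝ≥0∞) (x : G) : ℝ≥0∞ :=
  ∑' n, ∑ t ∈ Finset.range (n + 1), theta ^ (n + 1 - t) * increment b n (flip t x)

/-- The function majorizing the averaged envelope `b` over dyadic intervals of level `m`,
taken from level `m + d`. -/
noncomputable def remainder (b : ℕ → G → ℝ≥0∞) : ℕ → ℕ → G → ℝ≥0∞
  | 0, _, _ => 0
  | d + 1, m, x => theta * ((increment b m x + remainder b d (m + 1) x) +
      (increment b m (flip m x) + remainder b d (m + 1) (flip m x)))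

/-- The discounted sum `∑_{n < k} 2^{(n+1-k)/2} δ_n`. -/
noncomputable def discountedSum (δ : ℕ → ℝ≥0∞) (k : ℕ) : ℝ≥0∞ :=
  ∑ n ∈ Finset.range k, theta ^ (k - 1 - n) * δ n

theorem discountedSum_succ (δ : ℕ → ℝ≥0∞) (k : ℕ) :
    discountedSum δ (k + 1) = theta * discountedSum δ k + δ k := by
  rw [discountedSum, Finset.sum_range_succ, discountedSum, Finset.mul_sum]
  congr 1
  · refine Finset.sum_congr rfl fun n hn => ?_
    have := Finset.mem_range.1 hn
    rw [← mul_assoc, ← pow_succ']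
    congr 2
    omega
  · simp

theorem tsum_discountedSum_le (δ : ℕ → ℝ≥0∞) :
    ∑' k, discountedSum δ (k + 1) ≤ 4 * ∑' n, δ n := by
  -- The extra term `3 * discountedSum δ K` pays for the tail: one step turns it into 4θ times the
  -- same quantity.
  have key : ∀ K, ∑ k ∈ Finset.range K, discountedSum δ (k + 1) + 3 * discountedSum δ K ≤
      4 * ∑ n ∈ Finset.range K, δ n := by
    intro K
    induction K with
    | zero => simp [discountedSum]
    | succ K ih =>
      rw [Finset.sum_range_succ, Finset.sum_range_succ, discountedSum_succ]
      calc _ = ∑ k ∈ Finset.range K, discountedSum δ (k + 1) +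
            4 * theta * discountedSum δ K + 4 * δ K := by ring
        _ ≤ ∑ k ∈ Finset.range K, discountedSum δ (k + 1) +
            3 * discountedSum δ K + 4 * δ K := by
            gcongr
            exact four_mul_theta_le
        _ ≤ 4 * ∑ n ∈ Finset.range K, δ n + 4 * δ K := by gcongr
        _ = _ := by ring
  refine ENNReal.tsum_le_of_sum_range_le fun K => le_self_add.trans ((key K).trans ?_)
  gcongr
  exact ENNReal.sum_le_tsum _

namespace IsEnvelope

variable {b : ℕ → G → ℝ≥0∞}

theorem succ_eq (hb : IsEnvelope b) (n : ℕ) (x : G) : b (n + 1) x = b n x + increment b n x :=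
  (add_tsub_cancel_of_le (hb.le_succ n x)).symm

theorem measurable_increment (hb : IsEnvelope b) (n : ℕ) : Measurable (increment b n) :=
  (hb.measurable (n + 1)).sub (hb.measurable n)

theorem tsum_increment_le (hb : IsEnvelope b) {x : G} {B : ℝ≥0∞} (hB : ∀ n, b n x ≤ B) :
    ∑' n, increment b n x ≤ B := by
  refine ENNReal.tsum_le_of_sum_range_le fun N => ?_
  have key : b 0 x + ∑ n ∈ Finset.range N, increment b n x = b N x := by
    induction N with
    | zero => simp
    | succ N ih => rw [Finset.sum_range_succ, ← add_assoc, ih, ← hb.succ_eq]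
  exact le_add_self.trans (key.le.trans (hB N))

theorem tsum_lintegral_increment_le (hb : IsEnvelope b) {B : G → ℝ≥0∞}
    (hB : ∀ n x, b n x ≤ B x) : ∑' n, ∫⁻ x, increment b n x ∂mu ≤ ∫⁻ x, B x ∂mu := by
  rw [← lintegral_tsum fun n => (hb.measurable_increment n).aemeasurable]
  exact lintegral_mono fun x => hb.tsum_increment_le fun n => hB n x

/-- `B` bounds `b` at x only, not at its translates. Passing from k to k + 1 multiplies the old sum
by θ, adds a term t = k where the flip is invisible to `b k`, and adds the k-th increments, which
`incrementFlipSum` collects. -/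
theorem flipSum_le (hb : IsEnvelope b) {x : G} {B : ℝ≥0∞} (hB : ∀ n, b n x ≤ B) (k : ℕ) :
    flipSum k (b k) x ≤ 4 * B + incrementFlipSum b x := by
  have key : ∀ k, ∑ t ∈ Finset.range k, theta ^ (k - t) * b k (flip t x) ≤
      3 * B + ∑ n ∈ Finset.range k, ∑ t ∈ Finset.range (n + 1),
        theta ^ (n + 1 - t) * increment b n (flip t x) := by
    intro k
    induction k with
    | zero => simp
    | succ k ih =>
      have h : ∑ t ∈ Finset.range (k + 1), theta ^ (k + 1 - t) * b k (flip t x) =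
          theta * (∑ t ∈ Finset.range k, theta ^ (k - t) * b k (flip t x) + b k x) := by
        rw [Finset.sum_range_succ, mul_add, Finset.mul_sum]
        congr 1
        · refine Finset.sum_congr rfl fun t ht => ?_
          rw [Nat.succ_sub (Finset.mem_range.1 ht).le, pow_succ', mul_assoc]
        · simp [hb.flip_self]
      simp only [hb.succ_eq k, mul_add (theta ^ _), Finset.sum_add_distrib]
      rw [h, Finset.sum_range_succ (fun n => ∑ t ∈ Finset.range (n + 1),
        theta ^ (n + 1 - t) * increment b n (flip t x)), ← add_assoc]
      gcongr
      set S := ∑ n ∈ Finset.range k, ∑ t ∈ Finset.range (n + 1),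
        theta ^ (n + 1 - t) * increment b n (flip t x)
      calc theta * (∑ t ∈ Finset.range k, theta ^ (k - t) * b k (flip t x) + b k x)
          ≤ theta * (3 * B + S + B) := by
            gcongr
            exact hB k
        _ = 4 * theta * B + theta * S := by ring
        _ ≤ 3 * B + 1 * S := by
            gcongr
            · exact four_mul_theta_le
            · exact theta_le_one
        _ = 3 * B + S := by rw [one_mul]
  calc flipSum k (b k) x ≤ B + (3 * B + incrementFlipSum b x) :=
        add_le_add (hB k) ((key k).trans (by gcongr; exact ENNReal.sum_le_tsum _))
    _ = _ := by ring

theorem measurable_incrementFlipSum (hb : IsEnvelope b) : Measurable (incrementFlipSum b) :=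
  Measurable.tsum fun n => measurable_sum_flip (n + 1) (hb.measurable_increment n)

theorem lintegral_incrementFlipSum_le (hb : IsEnvelope b) {B : G → ℝ≥0∞}
    (hB : ∀ n x, b n x ≤ B x) :
    ∫⁻ x, incrementFlipSum b x ∂mu ≤ 3 * ∫⁻ x, B x ∂mu := by
  simp only [incrementFlipSum]
  rw [lintegral_tsum fun n =>
    (measurable_sum_flip (n + 1) (hb.measurable_increment n)).aemeasurable]
  calc _ ≤ ∑' n, 3 * ∫⁻ x, increment b n x ∂mu :=
        ENNReal.tsum_le_tsum fun n => lintegral_sum_flip_le (n + 1) (hb.measurable_increment n)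
    _ ≤ 3 * ∫⁻ x, B x ∂mu := by
        rw [ENNReal.tsum_mul_left]
        gcongr
        exact hb.tsum_lintegral_increment_le hB

theorem measurable_remainder (hb : IsEnvelope b) (d m : ℕ) : Measurable (remainder b d m) := by
  induction d generalizing m with
  | zero => exact measurable_const
  | succ d ih =>
    have h := (hb.measurable_increment m).add (ih (m + 1))
    exact (h.add (h.comp (measurable_flip m))).const_mul theta

/-- One recursion step multiplies the integral by 2θ, and 2θ² = 1, so the factor `theta ^ d` makes
the older errors decay geometrically. -/
theorem lintegral_remainder (hb : IsEnvelope b) (d m : ℕ) :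
    theta ^ d * ∫⁻ x, remainder b d m x ∂mu =
      ∑ j ∈ Finset.range d, theta ^ (d - 1 - j) * ∫⁻ x, increment b (m + j) x ∂mu := by
  induction d generalizing m with
  | zero => simp [remainder]
  | succ d ih =>
    have hm : Measurable fun x => increment b m x + remainder b d (m + 1) x :=
      (hb.measurable_increment m).add (hb.measurable_remainder d (m + 1))
    have h : ∫⁻ x, remainder b (d + 1) m x ∂mu = theta * (2 *
        (∫⁻ x, increment b m x ∂mu + ∫⁻ x, remainder b d (m + 1) x ∂mu)) := by
      simp only [remainder]
      rw [lintegral_const_mul' theta _ (theta_le_one.trans_lt ENNReal.one_lt_top).ne,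
        lintegral_add_left hm,
        lintegral_flip m hm, ← two_mul]
      congr 2
      exact lintegral_add_left (hb.measurable_increment m) _
    rw [h, Finset.sum_range_succ']
    calc _ = 2 * theta ^ 2 * (theta ^ d * ∫⁻ x, increment b m x ∂mu +
          theta ^ d * ∫⁻ x, remainder b d (m + 1) x ∂mu) := by ring
      _ = _ := by
        rw [two_mul_theta_sq, one_mul, ih, add_comm]
        congr 1
        refine Finset.sum_congr rfl fun j _ => ?_
        rw [add_right_comm m 1 j, add_assoc m j 1]
        congr 2
        omega

theorem theta_pow_mul_lintegral_remainder_le (hb : IsEnvelope b) (d m : ℕ) :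
    theta ^ d * ∫⁻ x, remainder b d m x ∂mu ≤
      discountedSum (fun n => ∫⁻ x, increment b n x ∂mu) (m + d) := by
  rw [hb.lintegral_remainder, discountedSum, Finset.sum_range_add]
  -- The terms of the discounted sum with index below `m` are discarded.
  refine le_add_left (Finset.sum_le_sum fun j _ => ?_)
  rw [show m + d - 1 - (m + j) = d - 1 - j by omega]

/-- With β = b_m, which is the same at x and at its flip, (β + p)² + (β + q)² ≤ 2(β + θ(p + q))²:
the cross terms use 1 ≤ 2θ and the squares use p² + q² ≤ 2θ²(p + q)². The coefficient of β stays 1,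
so the bound can be iterated. -/
theorem le_sq_add_remainder (hb : IsEnvelope b) {d m : ℕ} {x : G} {z z₁ z₂ : ℝ≥0∞}
    (h₁ : z₁ ≤ (b (m + 1) x + remainder b d (m + 1) x) ^ 2)
    (h₂ : z₂ ≤ (b (m + 1) (flip m x) + remainder b d (m + 1) (flip m x)) ^ 2)
    (hz : 2 * z ≤ z₁ + z₂) : z ≤ (b m x + remainder b (d + 1) m x) ^ 2 := by
  rw [hb.succ_eq, add_assoc] at h₁ h₂
  rw [hb.flip_self] at h₂
  rw [remainder]
  set p := increment b m x + remainder b d (m + 1) x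
  set q := increment b m (flip m x) + remainder b d (m + 1) (flip m x)
  refine (ENNReal.mul_le_mul_iff_right two_ne_zero ENNReal.ofNat_ne_top).1 (?_ : 2 * z ≤ _)
  calc 2 * z ≤ (b m x + p) ^ 2 + (b m x + q) ^ 2 := hz.trans (add_le_add h₁ h₂)
    _ = 2 * b m x ^ 2 + 1 * (2 * b m x * (p + q)) + (p ^ 2 + q ^ 2) := by ring
    _ ≤ 2 * b m x ^ 2 + 2 * theta * (2 * b m x * (p + q)) + (p + q) ^ 2 := by
        gcongr
        · exact one_le_two_mul_theta
        · exact sq_add_sq_le p q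
    _ = 2 * b m x ^ 2 + 2 * theta * (2 * b m x * (p + q)) + 2 * theta ^ 2 * (p + q) ^ 2 := by
        rw [two_mul_theta_sq, one_mul]
    _ = 2 * (b m x + theta * (p + q)) ^ 2 := by ring

/-- The block index m + d is fixed while m descends: at d = 0 the block is half a difference of two
values of S_{2^{m+1}} up to sign, and each further level averages over one flip. -/
theorem enorm_walshSum_shift_le (hb : IsEnvelope b) {c : ℕ → 𝕜}
    (hc : ∀ n x, ‖walshSum c (2 ^ n) x‖ₑ ≤ b n x ^ 2) (m d : ℕ) (x : G) :
    ‖walshSum (fun l => c (2 ^ (m + d) + l)) (2 ^ m) x‖ₑ ≤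
      (b m x + remainder b (d + 1) m x) ^ 2 := by
  induction d generalizing m x with
  | zero =>
    refine hb.le_sq_add_remainder (z₁ := ‖walshSum c (2 ^ (m + 1)) x‖ₑ)
      (z₂ := ‖walshSum c (2 ^ (m + 1)) (flip m x)‖ₑ) ?_ ?_ ?_
    · simpa [remainder] using hc (m + 1) x
    · simpa [remainder] using hc (m + 1) (flip m x)
    · rw [← enorm_two (𝕜 := 𝕜), ← enorm_mul, add_zero, two_mul_walshSum_shift,
        enorm_rademacher_smul]
      exact enorm_sub_le
  | succ d ih =>
    have h := ih (m + 1)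
    rw [add_right_comm m 1 d, add_assoc] at h
    refine hb.le_sq_add_remainder (h x) (h (flip m x)) ?_
    rw [← enorm_two (𝕜 := 𝕜), ← enorm_mul, two_mul_walshSum_two_pow]
    exact enorm_add_le _ _

/-- The integral of the function controlling the contribution of the high frequencies to the means
of order `2 ^ k + 2 ^ s k`. -/
theorem lintegral_tsum_flipSum_remainder_le (hb : IsEnvelope b) {B : G → ℝ≥0∞}
    (hB : ∀ n x, b n x ≤ B x) {s : ℕ → ℕ} (hs : ∀ k, s k ≤ k) :
    ∫⁻ x, ∑' k, theta ^ (k - s k) * flipSum (s k) (remainder b (k - s k + 1) (s k)) x ∂mu ≤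
      32 * ∫⁻ x, B x ∂mu := by
  have hm : ∀ k, Measurable (flipSum (s k) (remainder b (k - s k + 1) (s k))) := fun k =>
    measurable_flipSum _ (hb.measurable_remainder _ _)
  rw [lintegral_tsum fun k => ((hm k).const_mul _).aemeasurable]
  calc _ ≤ ∑' k, 8 * discountedSum (fun n => ∫⁻ x, increment b n x ∂mu) (k + 1) := by
        refine ENNReal.tsum_le_tsum fun k => ?_
        rw [lintegral_const_mul _ (hm k)]
        have h := hb.theta_pow_mul_lintegral_remainder_le (k - s k + 1) (s k)
        rw [← add_assoc, Nat.add_sub_cancel' (hs k)] at h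
        calc _ ≤ theta ^ (k - s k) * (4 * ∫⁻ x, remainder b (k - s k + 1) (s k) x ∂mu) := by
              gcongr
              exact lintegral_flipSum_le _ (hb.measurable_remainder _ _)
          _ = 4 * (1 * theta ^ (k - s k) * ∫⁻ x, remainder b (k - s k + 1) (s k) x ∂mu) := by
              ring
          -- The remainder has depth k - s + 1, one more than the available power of θ; the missing
          -- factor costs 2.
          _ ≤ 4 * (2 * theta * theta ^ (k - s k) *
                ∫⁻ x, remainder b (k - s k + 1) (s k) x ∂mu) := by
              gcongr
              exact one_le_two_mul_theta
          _ = 8 * (theta ^ (k - s k + 1) *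
                ∫⁻ x, remainder b (k - s k + 1) (s k) x ∂mu) := by ring
          _ ≤ _ := by gcongr
    _ ≤ 8 * (4 * ∫⁻ x, B x ∂mu) := by
        rw [ENNReal.tsum_mul_left]
        gcongr
        refine (tsum_discountedSum_le _).trans ?_
        gcongr
        exact hb.tsum_lintegral_increment_le hB
    _ = 32 * ∫⁻ x, B x ∂mu := by ring

end IsEnvelope

/-! ### Pointwise and norm estimates of Fejér means -/

/-- The square root of `max_{i ≤ n} |S_{2 ^ i}|` for the Walsh series with coefficients `c`. -/
noncomputable def sqrtMaximal (c : ℕ → 𝕜) : ℕ → G → ℝ≥0∞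
  | 0, x => ‖walshSum c (2 ^ 0) x‖ₑ ^ (1 / 2 : ℝ)
  | n + 1, x => max (sqrtMaximal c n x) (‖walshSum c (2 ^ (n + 1)) x‖ₑ ^ (1 / 2 : ℝ))

theorem measurable_sqrtMaximal (c : ℕ → 𝕜) (n : ℕ) : Measurable (sqrtMaximal c n) := by
  have h : ∀ i, Measurable fun x => ‖walshSum c (2 ^ i) x‖ₑ ^ (1 / 2 : ℝ) := fun i =>
    (measurable_walshSum c _).enorm.pow_const _
  induction n with
  | zero => exact h 0
  | succ n ih => exact ih.max (h (n + 1))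

theorem sqrtMaximal_flip (c : ℕ → 𝕜) {n t : ℕ} (h : n ≤ t) (x : G) :
    sqrtMaximal c n (flip t x) = sqrtMaximal c n x := by
  have hw : ∀ i ≤ t, walshSum c (2 ^ i) (flip t x) = walshSum c (2 ^ i) x := fun i hi =>
    walshSum_flip c (Nat.pow_le_pow_right two_pos hi) x
  induction n with
  | zero => rw [sqrtMaximal, hw 0 h, sqrtMaximal]
  | succ n ih => rw [sqrtMaximal, hw _ h, ih (by omega), sqrtMaximal]

theorem isEnvelope_sqrtMaximal (c : ℕ → 𝕜) : IsEnvelope (sqrtMaximal c) where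
  measurable := measurable_sqrtMaximal c
  le_succ _ _ := le_max_left _ _
  flip_self _ x := sqrtMaximal_flip c le_rfl x

theorem enorm_walshSum_le_sqrtMaximal_sq (c : ℕ → 𝕜) (n : ℕ) (x : G) :
    ‖walshSum c (2 ^ n) x‖ₑ ≤ sqrtMaximal c n x ^ 2 := by
  have h : ‖walshSum c (2 ^ n) x‖ₑ ^ (1 / 2 : ℝ) ≤ sqrtMaximal c n x := by
    cases n with
    | zero => exact le_rfl
    | succ n => exact le_max_right _ _
  calc ‖walshSum c (2 ^ n) x‖ₑ = (‖walshSum c (2 ^ n) x‖ₑ ^ (1 / 2 : ℝ)) ^ 2 := by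
        rw [← ENNReal.rpow_natCast, ← ENNReal.rpow_mul]
        norm_num
    _ ≤ _ := by gcongr

theorem sqrtMaximal_le {F : ℕ → G → 𝕜} (hF : Martingale F dyadicFiltration mu) (n : ℕ) (x : G) :
    sqrtMaximal (walshFourierCoeff F) n x ≤ maximalFunction F x ^ (1 / 2 : ℝ) := by
  have h : ∀ i, ‖walshSum (walshFourierCoeff F) (2 ^ i) x‖ₑ ^ (1 / 2 : ℝ) ≤
      maximalFunction F x ^ (1 / 2 : ℝ) := by
    intro i
    rw [walshSum_walshFourierCoeff_two_pow hF]
    gcongr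
    exact le_iSup (fun n => ‖F n x‖ₑ) i
  induction n with
  | zero => exact h 0
  | succ n ih => exact max_le ih (h (n + 1))

theorem enorm_inv_natCast_le {n k : ℕ} (h : 2 ^ k ≤ n) : ‖(n : 𝕜)⁻¹‖ₑ ≤ theta ^ (2 * k) := by
  have hn : n ≠ 0 := (lt_of_lt_of_le (pow_pos two_pos k) h).ne'
  have h1 : (n : ℝ≥0∞) * ‖(n : 𝕜)⁻¹‖ₑ = 1 := by
    rw [show (n : ℝ≥0∞) = ‖(n : 𝕜)‖ₑ by rw [← ofReal_norm, RCLike.norm_natCast]; simp,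
      ← enorm_mul, mul_inv_cancel₀ (Nat.cast_ne_zero.2 hn), enorm_one]
  calc ‖(n : 𝕜)⁻¹‖ₑ = theta ^ (2 * k) * (2 ^ k * ‖(n : 𝕜)⁻¹‖ₑ) := by
        rw [← mul_assoc, mul_comm (theta ^ _), two_pow_mul_theta_pow le_rfl]
        simp
    _ ≤ theta ^ (2 * k) * (n * ‖(n : 𝕜)⁻¹‖ₑ) := by
        gcongr
        exact_mod_cast h
    _ = theta ^ (2 * k) := by rw [h1, mul_one]

theorem enorm_fejerMean_two_pow_le (F : ℕ → G → 𝕜) (k : ℕ) (x : G) :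
    ‖fejerMean (2 ^ k) F x‖ₑ ≤
      flipSum k (sqrtMaximal (walshFourierCoeff F) k) x ^ 2 := by
  rw [fejerMean_eq, enorm_mul]
  refine le_trans ?_ (theta_pow_mul_enorm_fejerSum_le
    (enorm_walshSum_le_sqrtMaximal_sq (walshFourierCoeff F) k) x)
  gcongr
  exact enorm_inv_natCast_le le_rfl

/-- The sum splits into the Fejér sum of order 2^k, 2^s copies of S_{2^k}, and the shifted Fejér sum
of order 2^s; the first two give the same bound. -/
theorem enorm_fejerMean_two_pow_add_two_pow_le (F : ℕ → G → 𝕜) {k s : ℕ} (hs : s ≤ k) (x : G) :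
    ‖fejerMean (2 ^ k + 2 ^ s) F x‖ₑ ≤
      2 * flipSum k (sqrtMaximal (walshFourierCoeff F) k) x ^ 2 +
        (flipSum s (sqrtMaximal (walshFourierCoeff F) s) x + theta ^ (k - s) *
          flipSum s (remainder (sqrtMaximal (walshFourierCoeff F)) (k - s + 1) s) x) ^ 2 := by
  set c := walshFourierCoeff F
  have hb := isEnvelope_sqrtMaximal c
  have hc := enorm_walshSum_le_sqrtMaximal_sq c
  have h1 : theta ^ (2 * k) * ‖fejerSum c (2 ^ k) x‖ₑ ≤ flipSum k (sqrtMaximal c k) x ^ 2 :=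
    theta_pow_mul_enorm_fejerSum_le (hc k) x
  have h2 : theta ^ (2 * k) * (2 ^ s * ‖walshSum c (2 ^ k) x‖ₑ) ≤
      flipSum k (sqrtMaximal c k) x ^ 2 := by
    calc _ = (theta ^ (k - s)) ^ 2 * ‖walshSum c (2 ^ k) x‖ₑ := by
          rw [← two_pow_mul_theta_pow hs]
          ring
      _ ≤ 1 * sqrtMaximal c k x ^ 2 := by
          gcongr
          · exact pow_le_one₀ zero_le (pow_le_one₀ zero_le theta_le_one)
          · exact hc k x
      _ ≤ flipSum k (sqrtMaximal c k) x ^ 2 := by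
          rw [one_mul]
          gcongr
          exact le_flipSum _ _ _
  have h3 : theta ^ (2 * k) * ‖fejerSum (fun l => c (2 ^ k + l)) (2 ^ s) x‖ₑ ≤
      (flipSum s (sqrtMaximal c s) x +
        theta ^ (k - s) * flipSum s (remainder (sqrtMaximal c) (k - s + 1) s) x) ^ 2 := by
    have h := theta_pow_mul_enorm_fejerSum_le (hb.enorm_walshSum_shift_le hc s (k - s)) x
    rw [Nat.add_sub_cancel' hs, flipSum_add] at h
    calc _ = (theta ^ (k - s)) ^ 2 *
          (theta ^ (2 * s) * ‖fejerSum (fun l => c (2 ^ k + l)) (2 ^ s) x‖ₑ) := by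
          rw [← mul_assoc, ← pow_mul, ← pow_add]
          congr 2
          omega
      _ ≤ (theta ^ (k - s)) ^ 2 * (flipSum s (sqrtMaximal c s) x +
            flipSum s (remainder (sqrtMaximal c) (k - s + 1) s) x) ^ 2 := by gcongr
      _ = (theta ^ (k - s) * flipSum s (sqrtMaximal c s) x +
            theta ^ (k - s) * flipSum s (remainder (sqrtMaximal c) (k - s + 1) s) x) ^ 2 := by
          rw [← mul_pow, mul_add]
      _ ≤ (1 * flipSum s (sqrtMaximal c s) x +
            theta ^ (k - s) * flipSum s (remainder (sqrtMaximal c) (k - s + 1) s) x) ^ 2 := by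
          gcongr
          exact pow_le_one₀ zero_le theta_le_one
      _ = _ := by rw [one_mul]
  have h4 : ‖fejerSum c (2 ^ k + 2 ^ s) x‖ₑ ≤ ‖fejerSum c (2 ^ k) x‖ₑ +
      2 ^ s * ‖walshSum c (2 ^ k) x‖ₑ + ‖fejerSum (fun l => c (2 ^ k + l)) (2 ^ s) x‖ₑ := by
    rw [fejerSum_two_pow_add c (Nat.pow_le_pow_right two_pos hs)]
    refine (enorm_add₃_le).trans_eq ?_
    rw [enorm_rademacher_smul, enorm_mul, Nat.cast_pow, Nat.cast_ofNat, enorm_pow, enorm_two]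
  rw [fejerMean_eq, enorm_mul]
  calc _ ≤ theta ^ (2 * k) * (‖fejerSum c (2 ^ k) x‖ₑ + 2 ^ s * ‖walshSum c (2 ^ k) x‖ₑ +
        ‖fejerSum (fun l => c (2 ^ k + l)) (2 ^ s) x‖ₑ) := by
        gcongr
        exact enorm_inv_natCast_le le_self_add
    _ ≤ _ := by
        rw [mul_add, mul_add, two_mul (flipSum k _ x ^ 2)]
        exact add_le_add (add_le_add h1 h2) h3

theorem eLpNorm_one_half (f : G → ℝ≥0∞) :
    eLpNorm f (1 / 2) mu = (∫⁻ x, f x ^ (1 / 2 : ℝ) ∂mu) ^ 2 := by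
  rw [eLpNorm_eq_lintegral_rpow_enorm_toReal (by simp) (by simp)]
  simp only [enorm_eq_self, one_div, ENNReal.toReal_inv, ENNReal.toReal_ofNat, inv_inv]
  exact ENNReal.rpow_natCast _ 2

theorem measurable_restrictedMaximal (n : ℕ → ℕ) (F : ℕ → G → 𝕜) :
    Measurable (restrictedMaximal n F) := by
  refine Measurable.iSup fun k => ?_
  simp only [fejerMean_eq]
  exact ((measurable_fejerSum _ _).const_mul _).enorm

theorem boundedHardyLp_of_le_sq {n : ℕ → ℕ} (C : ℝ≥0)
    (h : ∀ F : ℕ → G → 𝕜, Martingale F dyadicFiltration mu → ∃ Z : G → ℝ≥0∞,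
      (∀ k x, ‖fejerMean (n k) F x‖ₑ ≤ Z x ^ 2) ∧
      ∫⁻ x, Z x ∂mu ≤ C * ∫⁻ x, maximalFunction F x ^ (1 / 2 : ℝ) ∂mu) :
    BoundedHardyLp (1 / 2) (restrictedMaximal (𝕜 := 𝕜) n) := by
  refine ⟨C ^ 2, fun F hF => ?_⟩
  obtain ⟨Z, hZ, hint⟩ := h F hF.1
  have hbound : eLpNorm (restrictedMaximal n F) (1 / 2) mu ≤
      (C ^ 2 : ℝ≥0) * hardyNorm (1 / 2) F := by
    rw [hardyNorm, eLpNorm_one_half, eLpNorm_one_half, ENNReal.coe_pow, ← mul_pow]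
    gcongr
    refine (lintegral_mono fun x => ?_).trans hint
    calc restrictedMaximal n F x ^ (1 / 2 : ℝ) ≤ (Z x ^ 2) ^ (1 / 2 : ℝ) := by
          gcongr
          exact iSup_le fun k => hZ k x
      _ = Z x := by
          rw [← ENNReal.rpow_natCast, ← ENNReal.rpow_mul]
          norm_num
  refine ⟨⟨(measurable_restrictedMaximal n F).aestronglyMeasurable, ?_⟩, hbound⟩
  exact hbound.trans_lt (ENNReal.mul_lt_top ENNReal.coe_lt_top hF.2)

theorem lintegral_majorant_le {F : ℕ → G → 𝕜} (hF : Martingale F dyadicFiltration mu) :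
    ∫⁻ x, (4 * maximalFunction F x ^ (1 / 2 : ℝ) +
      incrementFlipSum (sqrtMaximal (walshFourierCoeff F)) x) ∂mu ≤
      7 * ∫⁻ x, maximalFunction F x ^ (1 / 2 : ℝ) ∂mu := by
  have hb := isEnvelope_sqrtMaximal (walshFourierCoeff F)
  rw [lintegral_add_right _ hb.measurable_incrementFlipSum,
    lintegral_const_mul' _ _ ENNReal.ofNat_ne_top]
  calc _ ≤ 4 * ∫⁻ x, maximalFunction F x ^ (1 / 2 : ℝ) ∂mu +
        3 * ∫⁻ x, maximalFunction F x ^ (1 / 2 : ℝ) ∂mu := by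
        gcongr
        exact hb.lintegral_incrementFlipSum_le (sqrtMaximal_le hF)
    _ = _ := by ring

theorem boundedHardyLp_two_pow :
    BoundedHardyLp (1 / 2) (restrictedMaximal (𝕜 := 𝕜) fun k => 2 ^ k) := by
  refine boundedHardyLp_of_le_sq 7 fun F hF => ⟨_, fun k x => ?_, lintegral_majorant_le hF⟩
  refine (enorm_fejerMean_two_pow_le F k x).trans ?_
  gcongr
  exact (isEnvelope_sqrtMaximal _).flipSum_le (fun n => sqrtMaximal_le hF n x) k

/-- The restricted maximal operator `sup_k |σ_{2 ^ k + 2 ^ s(k)} F|` is bounded from `H_{1/2}` to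
`L_{1/2}` for every choice of exponents `s(k) ≤ k`. -/
theorem boundedHardyLp_two_pow_add_two_pow {s : ℕ → ℕ} (hs : ∀ k, s k ≤ k) :
    BoundedHardyLp (1 / 2) (restrictedMaximal (𝕜 := 𝕜) fun k => 2 ^ k + 2 ^ s k) := by
  -- 53 = 3 · 7 + 32, from the integrals of `Y` and `Z` in the majorant 3Y + Z.
  refine boundedHardyLp_of_le_sq 53 fun F hF => ?_
  set b := sqrtMaximal (walshFourierCoeff F)
  have hb : IsEnvelope b := isEnvelope_sqrtMaximal _
  set Y : G → ℝ≥0∞ := fun x => 4 * maximalFunction F x ^ (1 / 2 : ℝ) + incrementFlipSum b x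
  set Z : G → ℝ≥0∞ := fun x => ∑' k, theta ^ (k - s k) *
    flipSum (s k) (remainder b (k - s k + 1) (s k)) x
  have hYk : ∀ k x, flipSum k (b k) x ≤ Y x := fun k x =>
    hb.flipSum_le (fun n => sqrtMaximal_le hF n x) k
  have hZk : ∀ k x, theta ^ (k - s k) *
      flipSum (s k) (remainder b (k - s k + 1) (s k)) x ≤ Z x := fun k x =>
    ENNReal.le_tsum (f := fun k => theta ^ (k - s k) *
      flipSum (s k) (remainder b (k - s k + 1) (s k)) x) k
  have hZm : Measurable Z := Measurable.tsum fun k =>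
    (measurable_flipSum _ (hb.measurable_remainder _ _)).const_mul _
  refine ⟨fun x => 3 * Y x + Z x, fun k x => ?_, ?_⟩
  · calc ‖fejerMean (2 ^ k + 2 ^ s k) F x‖ₑ ≤ 2 * Y x ^ 2 + (Y x + Z x) ^ 2 := by
          refine (enorm_fejerMean_two_pow_add_two_pow_le F (hs k) x).trans ?_
          gcongr
          · exact hYk k x
          · exact hYk (s k) x
          · exact hZk k x
      _ ≤ 2 * Y x ^ 2 + (Y x + Z x) ^ 2 + (6 * Y x ^ 2 + 4 * Y x * Z x) := le_self_add
      _ = (3 * Y x + Z x) ^ 2 := by ring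
  · rw [lintegral_add_right _ hZm, lintegral_const_mul' _ _ ENNReal.ofNat_ne_top]
    calc _ ≤ 3 * (7 * ∫⁻ x, maximalFunction F x ^ (1 / 2 : ℝ) ∂mu) +
          32 * ∫⁻ x, maximalFunction F x ^ (1 / 2 : ℝ) ∂mu := by
          gcongr
          · exact lintegral_majorant_le hF
          · exact hb.lintegral_tsum_flipSum_remainder_le (sqrtMaximal_le hF) hs
      _ = (53 : ℝ≥0) * ∫⁻ x, maximalFunction F x ^ (1 / 2 : ℝ) ∂mu := by
          push_cast
          ring

end WalshFejer

theorem corollary2 {𝕜 : Type*} [RCLike 𝕜] :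
    WalshFejer.BoundedHardyLp (1 / 2)
        (WalshFejer.restrictedMaximal (𝕜 := 𝕜) (fun k => 2 ^ k)) ∧
      WalshFejer.BoundedHardyLp (1 / 2)
        (WalshFejer.restrictedMaximal (𝕜 := 𝕜) (fun k => 2 ^ k + 1)) ∧
      WalshFejer.BoundedHardyLp (1 / 2)
        (WalshFejer.restrictedMaximal (𝕜 := 𝕜) (fun k => 2 ^ k + 2 ^ (k / 2))) :=
  ⟨WalshFejer.boundedHardyLp_two_pow,
    -- The order 2^k + 1 is the case of exponent 0, since 2^0 reduces to 1.
    WalshFejer.boundedHardyLp_two_pow_add_two_pow (s := fun _ => 0) fun k => k.zero_le,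
    WalshFejer.boundedHardyLp_two_pow_add_two_pow fun k => Nat.div_le_self k 2⟩
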